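/- A dynamical system $(X,f)$ is a continuous map $f:X\to X$ of a compact metric space $X$ to itself. A dynamical system $(Y,g)$ is a factor of $(X,f)$ if there is a continuous surjection $\varphi:X\to Y$ with $g\varphi=\varphi f$. The $\omega$-limit set of $S\subseteq Y$ under $g$ is $\omega(S)=\bigcap_{n}\overline{\bigcup_{m>n}g^{m}(S)}$. Let $A,Q,B$ be finite sets. The discontinuum over $A,Q,B$ is the space $X$ of all two-sided sequences $u=(u_i)_{i\in\mathbb Z}$ with $u_i\in A$ for $i>0$, $u_0\in Q$ and $u_i\in B$ for $i<0$, with the metric $\varrho(u,v)=2^{-n}$, where $n=\inf\{i\ge 0 : u_i\ne v_i \text{ or } u_{-i}\ne v_{-i}\}$ (so that $\varrho(u,u)=0$). Given functions $f_A:Q\times A\to Q$ and $f_B:Q\to B$, the corresponding finite automaton over $A,Q,B$ is the dynamical system $(X,f)$ with $f(u)_{-1}=f_B(u_0)$, $f(u)_0=f_A(u_0,u_1)$ and $f(u)_i=u_{i+1}$ for all $i\notin\{-1,0\}$. Theorem. Let $(Y,g)$ be a dynamical system on a compact metric space for which $\omega(Y)$ is finite. Then $(Y,g)$ is a factor of a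 finite automaton. -/

import Mathlib

open Filter Topology

/-- The `ω`-limit set `ω(S)` of a set `S` under the iteration of `g` (Mathlib's `omegaLimit`
for the semi-flow `n ↦ g^[n]`). -/
def omegaSet {Y : Type*} [TopologicalSpace Y] (g : Y → Y) (S : Set Y) : Set Y :=
  omegaLimit atTop (fun (n : ℕ) (y : Y) => g^[n] y) S

/-- The `ω`-limit set in explicit form: `ω(S) = ⋂ₙ closure (⋃_{m > n} g^m(S))`. -/
theorem omegaSet_eq {Y : Type*} [TopologicalSpace Y] (g : Y → Y) (S : Set Y) :
    omegaSet g S = ⋂ n : ℕ, closure (⋃ m : ℕ, ⋃ _ : n < m, g^[m] '' S) := by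
  apply Set.Subset.antisymm
  · refine Set.subset_iInter fun n => ?_
    refine (Set.biInter_subset_of_mem (Ioi_mem_atTop n)).trans (closure_mono ?_)
    rintro _ ⟨m, hm, y, hy, rfl⟩
    exact Set.mem_iUnion₂.2 ⟨m, hm, y, hy, rfl⟩
  · refine Set.subset_iInter₂ fun u hu => ?_
    obtain ⟨n, hn⟩ := mem_atTop_sets.1 hu
    refine (Set.iInter_subset _ n).trans (closure_mono ?_)
    intro z hz
    obtain ⟨m, hm, y, hy, rfl⟩ := Set.mem_iUnion₂.1 hz
    exact ⟨m, hn m hm.le, y, hy, rfl⟩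

/-- `(Y, g)` is a factor of `(X, f)`: there is a continuous surjection `φ : X → Y`
with `g ∘ φ = φ ∘ f`. -/
def IsFactor {Y X : Type*} [TopologicalSpace Y] [TopologicalSpace X]
    (g : Y → Y) (f : X → X) : Prop :=
  ∃ φ : X → Y, Continuous φ ∧ Function.Surjective φ ∧ g ∘ φ = φ ∘ f

/-- The alphabet allowed at position `i ∈ ℤ`: `Q` at `0`, `A` at `i > 0`, and `B` at `i < 0`
(note that `Int.negSucc n` is `-(n + 1)`). -/
def Letter (A Q B : Type) : ℤ → Type
  | Int.ofNat 0 => Q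
  | Int.ofNat (_ + 1) => A
  | Int.negSucc _ => B

/-- The discontinuum over `A, Q, B`: two-sided sequences `u` with `u i ∈ A` for `i > 0`,
`u 0 ∈ Q` and `u i ∈ B` for `i < 0`. -/
def Discontinuum (A Q B : Type) : Type := ∀ i : ℤ, Letter A Q B i

namespace Discontinuum

variable {A Q B : Type}

open Classical in
/-- The distance `2 ^ (-n)` with `n = inf {i ≥ 0 | u i ≠ v i or u (-i) ≠ v (-i)}`;
it is `0` if `u = v` (the infimum of the empty set is `∞`). -/
noncomputable def rho (u v : Discontinuum A Q B) : ℝ :=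
  if u = v then 0
  else (1 / 2 : ℝ) ^ sInf {i : ℕ | u (i : ℤ) ≠ v (i : ℤ) ∨ u (-(i : ℤ)) ≠ v (-(i : ℤ))}

theorem rho_le_iff (u v : Discontinuum A Q B) (n : ℕ) :
    rho u v ≤ (1 / 2 : ℝ) ^ n ↔ ∀ i : ℤ, i.natAbs < n → u i = v i := by
  unfold rho
  split_ifs with h
  · subst h
    simp
  · have hne : {i : ℕ | u (i : ℤ) ≠ v (i : ℤ) ∨ u (-(i : ℤ)) ≠ v (-(i : ℤ))}.Nonempty := by
      by_contra hc
      apply h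
      funext i
      by_contra hi
      apply hc
      rcases Int.natAbs_eq i with h1 | h1
      · exact ⟨i.natAbs, Or.inl (by rwa [← h1])⟩
      · exact ⟨i.natAbs, Or.inr (by rwa [← h1])⟩
    rw [pow_le_pow_iff_right_of_lt_one₀ (by norm_num) (by norm_num)]
    constructor
    · intro hn i hi
      by_contra hc
      have : i.natAbs ∈ {i : ℕ | u (i : ℤ) ≠ v (i : ℤ) ∨ u (-(i : ℤ)) ≠ v (-(i : ℤ))} := by
        rcases Int.natAbs_eq i with h1 | h1
        · exact Or.inl (by rwa [← h1])
        · exact Or.inr (by rwa [← h1])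
      have := Nat.sInf_le this
      omega
    · intro hi
      by_contra hc
      push Not at hc
      rcases Nat.sInf_mem hne with h1 | h1
      · exact h1 (hi _ (by simpa using hc))
      · exact h1 (hi _ (by simpa using hc))

theorem rho_eq (u v : Discontinuum A Q B) :
    rho u v = 0 ∨ ∃ n : ℕ, rho u v = (1 / 2 : ℝ) ^ n := by
  unfold rho
  split_ifs
  · exact Or.inl rfl
  · exact Or.inr ⟨_, rfl⟩

theorem rho_nonneg (u v : Discontinuum A Q B) : 0 ≤ rho u v := by
  unfold rho
  split_ifs <;> positivity

theorem rho_self (u : Discontinuum A Q B) : rho u u = 0 := by simp [rho]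

theorem eq_of_rho (u v : Discontinuum A Q B) (h : rho u v = 0) : u = v := by
  unfold rho at h
  split_ifs at h with h1
  · exact h1
  · exact absurd h (by positivity)

theorem rho_comm (u v : Discontinuum A Q B) : rho u v = rho v u := by
  by_cases h : u = v
  · rw [h]
  · simp only [rho, if_neg h, if_neg (Ne.symm h), ne_comm]

theorem rho_triangle (u v w : Discontinuum A Q B) : rho u w ≤ rho u v + rho v w := by
  rcases rho_eq u v with h1 | ⟨n, h1⟩
  · rw [eq_of_rho u v h1, rho_self, zero_add]
  rcases rho_eq v w with h2 | ⟨m, h2⟩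
  · rw [eq_of_rho v w h2, rho_self, add_zero]
  have hn := (rho_le_iff u v n).1 h1.le
  have hm := (rho_le_iff v w m).1 h2.le
  have key : rho u w ≤ (1 / 2 : ℝ) ^ min n m := (rho_le_iff u w _).2 fun i hi =>
    (hn i (lt_of_lt_of_le hi (min_le_left _ _))).trans
      (hm i (lt_of_lt_of_le hi (min_le_right _ _)))
  have a1 := rho_nonneg u v
  have a2 := rho_nonneg v w
  rcases le_total n m with h | h
  · rw [min_eq_left h, ← h1] at key
    linarith
  · rw [min_eq_right h, ← h2] at key
    linarith

noncomputable instance : MetricSpace (Discontinuum A Q B) where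
  dist := rho
  dist_self := rho_self
  dist_comm := rho_comm
  dist_triangle := rho_triangle
  eq_of_dist_eq_zero := fun {u v} h => eq_of_rho u v h

theorem dist_le_iff (u v : Discontinuum A Q B) (n : ℕ) :
    dist u v ≤ (1 / 2 : ℝ) ^ n ↔ ∀ i : ℤ, i.natAbs < n → u i = v i :=
  rho_le_iff u v n

/-- A discontinuum over finite sets is a compact metric space. -/
instance [Finite A] [Finite Q] [Finite B] : CompactSpace (Discontinuum A Q B) := by
  let _ : ∀ i, TopologicalSpace (Letter A Q B i) := fun _ => ⊥
  have : ∀ i, DiscreteTopology (Letter A Q B i) := fun _ => ⟨rfl⟩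
  have : ∀ i, Finite (Letter A Q B i) := fun i =>
    match i with
    | Int.ofNat 0 => inferInstanceAs (Finite Q)
    | Int.ofNat (_ + 1) => inferInstanceAs (Finite A)
    | Int.negSucc _ => inferInstanceAs (Finite B)
  let e : (∀ i, Letter A Q B i) → Discontinuum A Q B := fun u => u
  have he : Continuous e := by
    rw [continuous_iff_continuousAt]
    intro u
    rw [ContinuousAt, Metric.tendsto_nhds]
    intro ε hε
    obtain ⟨n, hn⟩ := exists_pow_lt_of_lt_one hε (by norm_num : (1 / 2 : ℝ) < 1)
    have hfin : {i : ℤ | i.natAbs < n}.Finite :=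
      (Set.finite_Icc (-(n : ℤ)) n).subset fun i (hi : i.natAbs < n) => by
        rw [Set.mem_Icc]
        omega
    have hev : ∀ᶠ v in 𝓝 u, ∀ i ∈ {i : ℤ | i.natAbs < n}, v i = u i := by
      rw [eventually_all_finite hfin]
      intro i _
      exact (continuous_apply i).continuousAt.eventually
        ((isOpen_discrete {u i}).mem_nhds rfl)
    filter_upwards [hev] with v hv
    exact lt_of_le_of_lt ((dist_le_iff (e v) (e u) n).2 hv) hn
  exact Function.Surjective.compactSpace (f := e) he (fun u => ⟨u, rfl⟩)

end Discontinuum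

/-- The data of a finite automaton with input alphabet `A`, set of inner states `Q` and output
alphabet `B`: the input function `f_A : Q × A → Q` and the output function `f_B : Q → B`. -/
structure FiniteAutomaton (A Q B : Type) where
  fA : Q × A → Q
  fB : Q → B

/-- The map `f` of the discontinuum given by `f(u)₋₁ = f_B(u₀)`, `f(u)₀ = f_A(u₀, u₁)` and
`f(u)ᵢ = uᵢ₊₁` for all other `i`. -/
def FiniteAutomaton.step {A Q B : Type} (M : FiniteAutomaton A Q B)
    (u : Discontinuum A Q B) : Discontinuum A Q B
  | Int.ofNat 0 => M.fA (u 0, u 1)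
  | Int.ofNat (n + 1) => u (Int.ofNat (n + 2))
  | Int.negSucc 0 => M.fB (u 0)
  | Int.negSucc (n + 1) => u (Int.negSucc n)

/-- A finite automaton is a dynamical system: its map is continuous. -/
theorem FiniteAutomaton.continuous_step {A Q B : Type} (M : FiniteAutomaton A Q B) :
    Continuous M.step := by
  rw [Metric.continuous_iff]
  intro v ε hε
  obtain ⟨n, hn⟩ := exists_pow_lt_of_lt_one hε (by norm_num : (1 / 2 : ℝ) < 1)
  refine ⟨(1 / 2 : ℝ) ^ (n + 2), by positivity, fun u hu => lt_of_le_of_lt ?_ hn⟩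
  have h := (Discontinuum.dist_le_iff u v (n + 2)).1 hu.le
  refine (Discontinuum.dist_le_iff _ _ n).2 fun i hi => ?_
  match i, hi with
  | Int.ofNat 0, _ =>
    change M.fA (u 0, u 1) = M.fA (v 0, v 1)
    have h0 : u 0 = v 0 := h 0 (by simp)
    have h1 : u 1 = v 1 := h 1 (by simp)
    rw [h0, h1]
  | Int.ofNat (k + 1), hi => exact h (Int.ofNat (k + 2)) (by simp at hi ⊢; omega)
  | Int.negSucc 0, _ => exact congrArg M.fB (h 0 (by simp))
  | Int.negSucc (k + 1), hi => exact h (Int.negSucc k) (by simp at hi ⊢; omega)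

/-- `(Y, g)` is a factor of a finite automaton over some finite sets `A, Q, B`. -/
def IsFactorOfFiniteAutomaton {Y : Type*} [TopologicalSpace Y] (g : Y → Y) : Prop :=
  ∃ (A Q B : Type) (_ : Finite A) (_ : Finite Q) (_ : Finite B) (M : FiniteAutomaton A Q B),
    IsFactor g M.step

/-! On the finite set `ω(Y)` the map `g` is a permutation `π`, and by compactness the iterates of
all points approach `ω(Y)` uniformly. So each point has a label, the limit point whose orbit it
shadows; this gives a continuous `r` with `r ∘ g = π ∘ r`. Each fibre of `r` is compact, hence the
image of the Cantor space under some `h q`. The automaton has the limit points as states, moves them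
by `π`, ignores its input and always outputs `0`. State `q` with output `0ⁿ1b` encodes `gⁿ(h (π⁻ⁿ q)
b)`: a new `0` means one more step of `g`. Uniform attraction makes this continuous at `0^∞`, which
encodes `ι q`; `n = 0` already yields every point. -/

theorem iterate_semiconj_perm {Y Q : Type*} {g : Y → Y} {π : Equiv.Perm Q} {ι : Q → Y}
    (h : ∀ q, g (ι q) = ι (π q)) (n : ℕ) (q : Q) : g^[n] (ι q) = ι ((π ^ n) q) := by
  rw [Equiv.Perm.coe_pow]
  exact ((Function.Semiconj.iterate_right (f := ι) (ga := π) (gb := g) (fun q => (h q).symm) n)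
    q).symm

section OmegaLimit

variable {Y : Type*} [TopologicalSpace Y] {g : Y → Y}

theorem eventually_iterate_mem_of_omegaSet_subset [CompactSpace Y] {V : Set Y} (hV : IsOpen V)
    (hs : omegaSet g Set.univ ⊆ V) : ∀ᶠ n in atTop, ∀ y, g^[n] y ∈ V :=
  (eventually_mapsTo_of_isOpen_of_omegaLimit_subset _ _ _ hV hs).mono fun _ hn y =>
    hn (Set.mem_univ y)

theorem mapsTo_omegaSet (hg : Continuous g) (S : Set Y) :
    Set.MapsTo g (omegaSet g S) (omegaSet g S) := by
  intro y hy
  rw [omegaSet_eq, Set.mem_iInter] at hy ⊢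
  intro n
  refine map_mem_closure hg (hy n) ?_
  intro z hz
  obtain ⟨m, hm, x, hx, rfl⟩ := Set.mem_iUnion₂.1 hz
  exact Set.mem_iUnion₂.2 ⟨m + 1, hm.trans m.lt_succ_self, x, hx, Function.iterate_succ_apply' g m x⟩

/-- A limit point outside the compact image of `ω(Y)` could be separated from it by open sets, but
all late iterates of `Y` stay near that image. -/
theorem surjOn_omegaSet_univ [CompactSpace Y] [T2Space Y] (hg : Continuous g) :
    Set.SurjOn g (omegaSet g Set.univ) (omegaSet g Set.univ) := by
  intro q hq
  by_contra hc
  have hK : IsCompact (g '' omegaSet g Set.univ) :=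
    (isClosed_omegaLimit _ _ _).isCompact.image hg
  obtain ⟨U, W, hU, hW, hKU, hqW, hd⟩ :=
    SeparatedNhds.of_isCompact_isCompact hK isCompact_singleton
      (Set.disjoint_singleton_right.2 hc)
  obtain ⟨n, hn⟩ := (eventually_iterate_mem_of_omegaSet_subset (hU.preimage hg)
    (Set.image_subset_iff.1 hKU)).exists_forall_of_atTop
  rw [omegaSet_eq, Set.mem_iInter] at hq
  obtain ⟨z, hzW, hz⟩ := mem_closure_iff.1 (hq n) W hW (hqW rfl)
  obtain ⟨m, hm, x, -, rfl⟩ := Set.mem_iUnion₂.1 hz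
  obtain ⟨m, rfl⟩ : ∃ k, m = k + 1 := ⟨m - 1, by omega⟩
  refine Set.disjoint_left.1 hd (hn m (by omega) x) ?_
  rwa [Function.iterate_succ_apply'] at hzW

theorem exists_perm_of_range_eq_omegaSet [CompactSpace Y] [T2Space Y] (hg : Continuous g)
    {Q : Type*} [Finite Q] {ι : Q → Y} (hι : ι.Injective)
    (hr : Set.range ι = omegaSet g Set.univ) :
    ∃ π : Equiv.Perm Q, ∀ q, g (ι q) = ι (π q) := by
  have hmem (q : Q) : ι q ∈ omegaSet g Set.univ := hr ▸ Set.mem_range_self q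
  have h (q : Q) : ∃ q', g (ι q) = ι q' := by
    have := mapsTo_omegaSet hg Set.univ (hmem q)
    rw [← hr] at this
    obtain ⟨q', hq'⟩ := this
    exact ⟨q', hq'.symm⟩
  choose σ hσ using h
  have hsurj : σ.Surjective := fun q => by
    obtain ⟨y, hy, hgy⟩ := surjOn_omegaSet_univ hg (hmem q)
    rw [← hr] at hy
    obtain ⟨q', rfl⟩ := hy
    exact ⟨q', hι ((hσ q').symm.trans hgy)⟩
  exact ⟨Equiv.ofBijective σ (Finite.injective_iff_bijective.1
    (Finite.injective_iff_surjective.2 hsurj)), hσ⟩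

/-- The map sending a point to the point of the finite `ω`-limit set whose orbit it shadows. -/
theorem exists_retraction_of_range_eq_omegaSet [CompactSpace Y] [T2Space Y] (hg : Continuous g)
    {Q : Type*} [Finite Q] [TopologicalSpace Q] [DiscreteTopology Q] {ι : Q → Y}
    (hι : ι.Injective) (hr : Set.range ι = omegaSet g Set.univ) {π : Equiv.Perm Q}
    (hπ : ∀ q, g (ι q) = ι (π q)) :
    ∃ r : Y → Q, Continuous r ∧ (∀ y, r (g y) = π (r y)) ∧ ∀ q, r (ι q) = q := by
  obtain ⟨U, hU, hd⟩ := (Set.finite_range ι).t2_separation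
  have huniq {p q : Q} {z : Y} (hp : z ∈ U (ι p)) (hq : z ∈ U (ι q)) : p = q :=
    hι (hd.elim_set ⟨p, rfl⟩ ⟨q, rfl⟩ z hp hq)
  -- The second condition makes the label of the next iterate the `π`-image of the current one.
  let V (q : Q) : Set Y := U (ι q) ∩ g ⁻¹' U (ι (π q))
  have hV (q : Q) : IsOpen (V q) := (hU _).2.inter ((hU _).2.preimage hg)
  have hιV (q : Q) : ι q ∈ V q := ⟨(hU _).1, by rw [Set.mem_preimage, hπ]; exact (hU _).1⟩
  obtain ⟨n, hn⟩ := (eventually_iterate_mem_of_omegaSet_subset (V := ⋃ q, V q) (isOpen_iUnion hV)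
    (by
      rw [← hr]
      rintro _ ⟨q, rfl⟩
      exact Set.mem_iUnion.2 ⟨q, hιV q⟩)).exists
  choose s hs using fun y => Set.mem_iUnion.1 (hn y)
  have hs_eq {y : Y} {q : Q} (h : g^[n] y ∈ U (ι q)) : s y = q := huniq (hs y).1 h
  have hsc : Continuous s := continuous_discrete_rng.2 fun q => by
    have : s ⁻¹' {q} = g^[n] ⁻¹' V q := by
      ext y
      exact ⟨fun h => by rw [← (h : s y = q)]; exact hs y, fun h => hs_eq h.1⟩
    rw [this]
    exact (hV q).preimage (hg.iterate n)
  -- `s` labels `g^[n] y`; undoing `n` steps of `π` gives the label of `y` itself.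
  refine ⟨fun y => (π ^ n)⁻¹ (s y), continuous_of_discreteTopology.comp hsc, fun y => ?_,
    fun q => ?_⟩
  · have : s (g y) = π (s y) := hs_eq (by
      rw [← Function.iterate_succ_apply, Function.iterate_succ_apply']
      exact (hs y).2)
    change (π ^ n)⁻¹ (s (g y)) = π ((π ^ n)⁻¹ (s y))
    rw [this, ← Equiv.Perm.mul_apply, ← Equiv.Perm.mul_apply,
      ((Commute.refl π).pow_left n).inv_left.eq]
  · have : s (ι q) = (π ^ n) q := hs_eq (by
      rw [iterate_semiconj_perm hπ]
      exact (hU _).1)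
    change (π ^ n)⁻¹ (s (ι q)) = q
    rw [this]
    exact (π ^ n).symm_apply_apply q

end OmegaLimit

section DelayedOrbit

variable {Y Q : Type*}

open Classical in
/-- The point of `Y` encoded by a state `q` and a binary sequence `0ⁿ1b`: the one reached at state
`q` after `n` steps from the point `h p b`, where `n` steps of `π` take `p` to `q`. The sequence
`0^∞` encodes `ι q`. -/
noncomputable def delayedOrbit (g : Y → Y) (π : Equiv.Perm Q) (ι : Q → Y)
    (h : Q → (ℕ → Bool) → Y) (x : Q × (ℕ → Bool)) : Y :=
  if H : ∃ n, x.2 n = true then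
    g^[Nat.find H] (h ((π ^ Nat.find H)⁻¹ x.1) fun k => x.2 (Nat.find H + 1 + k))
  else ι x.1

variable {g : Y → Y} {π : Equiv.Perm Q} {ι : Q → Y} {h : Q → (ℕ → Bool) → Y}

theorem delayedOrbit_of_first {q : Q} {b : ℕ → Bool} {n : ℕ} (hn : b n = true)
    (hlt : ∀ m < n, b m = false) :
    delayedOrbit g π ι h (q, b) = g^[n] (h ((π ^ n)⁻¹ q) fun k => b (n + 1 + k)) := by
  have key (N : ℕ) (hN : N = n) : g^[N] (h ((π ^ N)⁻¹ q) fun k => b (N + 1 + k)) =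
      g^[n] (h ((π ^ n)⁻¹ q) fun k => b (n + 1 + k)) := by rw [hN]
  unfold delayedOrbit
  rw [dif_pos ⟨n, hn⟩]
  exact key _ ((Nat.find_eq_iff _).2 ⟨hn, fun m hm => by simp [hlt m hm]⟩)

theorem delayedOrbit_of_forall {q : Q} {b : ℕ → Bool} (hb : ∀ n, b n = false) :
    delayedOrbit g π ι h (q, b) = ι q := by
  unfold delayedOrbit
  rw [dif_neg]
  simp [hb]

theorem exists_first_or_forall (b : ℕ → Bool) :
    (∃ n, b n = true ∧ ∀ m < n, b m = false) ∨ ∀ n, b n = false := by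
  by_cases H : ∃ n, b n = true
  · exact Or.inl ⟨Nat.find H, Nat.find_spec H, fun m hm => by simpa using Nat.find_min H hm⟩
  · exact Or.inr (by simpa using H)

theorem delayedOrbit_step (hπ : ∀ q, g (ι q) = ι (π q)) {q : Q} {b c : ℕ → Bool}
    (h0 : c 0 = false) (hc : ∀ n, c (n + 1) = b n) :
    g (delayedOrbit g π ι h (q, b)) = delayedOrbit g π ι h (π q, c) := by
  rcases exists_first_or_forall b with ⟨n, hn, hlt⟩ | hb
  · rw [delayedOrbit_of_first hn hlt, delayedOrbit_of_first (n := n + 1) ((hc n).trans hn)]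
    · rw [Function.iterate_succ_apply', pow_succ', mul_inv_rev, Equiv.Perm.mul_apply,
        show π⁻¹ (π q) = q from π.symm_apply_apply q]
      congr 3
      funext k
      rw [show n + 1 + 1 + k = n + 1 + k + 1 by omega, hc]
    · rintro (_ | m) hm
      · exact h0
      · rw [hc]
        exact hlt m (by omega)
  · rw [delayedOrbit_of_forall hb, hπ, delayedOrbit_of_forall]
    rintro (_ | m)
    · exact h0
    · rw [hc, hb]

theorem delayedOrbit_cons_true {q : Q} {b c : ℕ → Bool} (h0 : c 0 = true)
    (hc : ∀ n, c (n + 1) = b n) : delayedOrbit g π ι h (q, c) = h q b := by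
  rw [delayedOrbit_of_first h0 (by simp)]
  simp only [Function.iterate_zero, id, pow_zero, inv_one, Equiv.Perm.one_apply]
  congr 1
  funext k
  rw [show 0 + 1 + k = k + 1 by omega, hc]

/-- Near a sequence containing a `1` the position of the first `1` is constant, so one continuous
formula applies. Near `0^∞` the delay is large, and attraction to `ω(Y)` takes over. -/
theorem continuous_delayedOrbit [TopologicalSpace Y] [CompactSpace Y] (hg : Continuous g)
    [TopologicalSpace Q] [DiscreteTopology Q]
    (hr : Set.range ι = omegaSet g Set.univ) {r : Y → Q} (hrc : Continuous r)
    (hrg : ∀ y, r (g y) = π (r y)) (hrι : ∀ q, r (ι q) = q)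
    (hc : ∀ q, Continuous (h q)) (hrh : ∀ q b, r (h q b) = q) :
    Continuous (delayedOrbit g π ι h) := by
  have hriter (n : ℕ) (y : Y) : r (g^[n] y) = (π ^ n) (r y) := by
    rw [Equiv.Perm.coe_pow]
    exact Function.Semiconj.iterate_right (f := r) (ga := g) (gb := π) hrg n y
  have hcoord (q : Q) (b : ℕ → Bool) (n : ℕ) :
      ∀ᶠ x : Q × (ℕ → Bool) in 𝓝 (q, b), x.1 = q ∧ ∀ m ≤ n, x.2 m = b m := by
    have hb (m : ℕ) : Continuous fun x : Q × (ℕ → Bool) => x.2 m := by fun_prop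
    exact ((isOpen_discrete {q}).preimage continuous_fst).eventually_mem rfl |>.and <|
      (Set.finite_Iic n).eventually_all.2 fun m _ =>
        ((isOpen_discrete {b m}).preimage (hb m)).eventually_mem rfl
  rw [continuous_iff_continuousAt]
  rintro ⟨q, b⟩
  rcases exists_first_or_forall b with ⟨n, hn, hlt⟩ | hb
  · have hcont : Continuous fun x : Q × (ℕ → Bool) =>
        g^[n] (h ((π ^ n)⁻¹ q) fun k => x.2 (n + 1 + k)) :=
      (hg.iterate n).comp ((hc _).comp (by fun_prop))
    refine hcont.continuousAt.congr ?_
    filter_upwards [hcoord q b n] with x hx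
    obtain ⟨p, c⟩ := x
    obtain ⟨rfl, hx⟩ := hx
    exact (delayedOrbit_of_first ((hx n le_rfl).trans hn)
      fun m hm => (hx m hm.le).trans (hlt m hm)).symm
  · rw [ContinuousAt, delayedOrbit_of_forall hb, tendsto_nhds]
    intro W hW hqW
    -- This open set contains all of `ω(Y)`: `W` covers `ι q`, and the other labels cover the rest.
    -- A late iterate with label `q` must therefore lie in `W`.
    have hV : IsOpen (W ∪ r ⁻¹' {q}ᶜ) := hW.union ((isOpen_discrete _).preimage hrc)
    obtain ⟨n, hn⟩ := (eventually_iterate_mem_of_omegaSet_subset hV (by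
      rw [← hr]
      rintro _ ⟨p, rfl⟩
      by_cases hp : p = q
      · exact Or.inl (hp ▸ hqW)
      · exact Or.inr (by simpa [hrι] using hp))).exists_forall_of_atTop
    filter_upwards [hcoord q b n] with x hx
    obtain ⟨p, c⟩ := x
    obtain ⟨rfl, hx⟩ := hx
    change delayedOrbit g π ι h (p, c) ∈ W
    rcases exists_first_or_forall c with ⟨m, hm, hlt⟩ | hc0
    · rw [delayedOrbit_of_first hm hlt]
      have hnm : n ≤ m := by
        by_contra hmn
        have := hx m (by omega)
        simp only [hm, hb] at this
        exact absurd this (by decide)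
      refine (hn m hnm _).resolve_right ?_
      simp [hriter, hrh]
    · rwa [delayedOrbit_of_forall hc0]

end DelayedOrbit

/-- A function of a discontinuum that depends on one coordinate only is continuous. -/
theorem Discontinuum.continuous_of_coordinate {A Q B Z : Type} [TopologicalSpace Z] (i : ℤ)
    {p : Discontinuum A Q B → Z} (hp : ∀ u v, u i = v i → p u = p v) : Continuous p := by
  rw [continuous_iff_continuousAt]
  intro u
  refine (continuousAt_const (y := p u)).congr ?_
  filter_upwards [Metric.closedBall_mem_nhds u
    (by positivity : (0 : ℝ) < (1 / 2 : ℝ) ^ (i.natAbs + 1))] with v hv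
  exact (hp v u ((Discontinuum.dist_le_iff v u _).1 hv i i.natAbs.lt_succ_self)).symm

/-- Every fibre of a continuous map from a compact metric space to a discrete space is, if
nonempty, a continuous image of the Cantor space. -/
theorem exists_continuous_range_eq_fiber {Y Q : Type*} [MetricSpace Y] [CompactSpace Y]
    [TopologicalSpace Q] [DiscreteTopology Q] {r : Y → Q} (hr : Continuous r) {q : Q}
    (hq : ∃ y, r y = q) :
    ∃ h : (ℕ → Bool) → Y, Continuous h ∧ Set.range h = r ⁻¹' {q} := by
  have : CompactSpace (r ⁻¹' {q}) :=
    isCompact_iff_compactSpace.1 ((isClosed_discrete {q}).preimage hr).isCompact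
  have : Nonempty (r ⁻¹' {q}) := let ⟨y, hy⟩ := hq; ⟨⟨y, hy⟩⟩
  obtain ⟨f, hf, hfs⟩ := exists_nat_bool_continuous_surjective_of_compact (r ⁻¹' {q})
  exact ⟨Subtype.val ∘ f, continuous_subtype_val.comp hf, by
    rw [hfs.range_comp, Subtype.range_coe]⟩

theorem mainTheorem2 {Y : Type*} [MetricSpace Y] [CompactSpace Y] (g : Y → Y)
    (hg : Continuous g) (hω : (omegaSet g Set.univ).Finite) :
    IsFactorOfFiniteAutomaton g := by
  obtain ⟨k, ι, hι, hrange⟩ := hω.fin_param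
  obtain ⟨π, hπ⟩ := exists_perm_of_range_eq_omegaSet hg hι hrange
  obtain ⟨r, hrc, hrg, hrι⟩ := exists_retraction_of_range_eq_omegaSet hg hι hrange hπ
  choose h hc hh using fun q => exists_continuous_range_eq_fiber hrc ⟨ι q, hrι q⟩
  have hrh (q : Fin k) (b : ℕ → Bool) : r (h q b) = q :=
    (hh q ▸ Set.mem_range_self b : h q b ∈ r ⁻¹' {q})
  let M : FiniteAutomaton Unit (Fin k) Bool := ⟨fun x => π x.1, fun _ => false⟩
  let state (u : Discontinuum Unit (Fin k) Bool) : Fin k := u 0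
  let output (n : ℕ) (u : Discontinuum Unit (Fin k) Bool) : Bool := u (Int.negSucc n)
  have hstate : Continuous state :=
    Discontinuum.continuous_of_coordinate 0 fun _ _ huv => huv
  have houtput (n : ℕ) : Continuous (output n) :=
    Discontinuum.continuous_of_coordinate (Int.negSucc n) fun _ _ huv => huv
  refine ⟨Unit, Fin k, Bool, inferInstance, inferInstance, inferInstance, M,
    fun u => delayedOrbit g π ι h (state u, fun n => output n u),
    (continuous_delayedOrbit hg hrange hrc hrg hrι hc hrh).comp
      (hstate.prodMk (continuous_pi houtput)), fun y => ?_,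
    funext fun u => delayedOrbit_step hπ rfl fun _ => rfl⟩
  obtain ⟨b, hb⟩ : y ∈ Set.range (h (r y)) := by rw [hh]; rfl
  -- The `1` at position `-1` means delay zero, so `u` encodes `h (r y) b = y`.
  let u : Discontinuum Unit (Fin k) Bool := fun
    | Int.ofNat 0 => r y
    | Int.ofNat (_ + 1) => ()
    | Int.negSucc 0 => true
    | Int.negSucc (n + 1) => b n
  exact ⟨u, (delayedOrbit_cons_true rfl fun _ => rfl).trans hb⟩
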